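/- For $\ell\ge 0$ let $V^\ell$ be the irreducible real orthogonal representation of $\mathrm{SO}(3)$ of dimension $2\ell+1$, realised on the space of harmonic homogeneous polynomials of degree $\ell$ on $\mathbb{R}^3$ with $(g\cdot p)(x)=p(g^{-1}x)$. Let $V^+$ be the trivial representation and $V^-$ the representation $z\mapsto\det z$ of the group $\{\pm e\}\subset\mathrm{O}(3)$, where $e$ is the identity matrix. Using $\mathrm{O}(3)=\mathrm{SO}(3)\times\{\pm e\}$, let $V^{\ell\pm}=V^\ell\otimes V^\pm$ be the representation of $\mathrm{O}(3)$ in which $gz$ acts as $g\otimes z$ for $g\in\mathrm{SO}(3)$, $z\in\{\pm e\}$. Embed $\mathrm{O}(2)$ into $\mathrm{O}(3)$ by $k\mapsto\begin{pmatrix}k&0\\0&1\end{pmatrix}$. Let $E^{0+}(k)=1$ and $E^{0-}(k)=\det k$ for $k\in\mathrm{O}(2)$, and for $m\ge 1$ let $E^m$ be the representation of $\mathrm{O}(2)$ on $\mathbb{R}^2$ with \[ E^m\begin{pmatrix}\cos\varphi&-\sin\varphi\\ \sin\varphi&\cos\varphi\end{pmatrix}=\begin{pmatrix}\cos m\varphi&-\sin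 m\varphi\\ \sin m\varphi&\cos m\varphi\end{pmatrix},\qquad E^m\begin{pmatrix}\cos\varphi&\sin\varphi\\ \sin\varphi&-\cos\varphi\end{pmatrix}=\begin{pmatrix}\cos m\varphi&\sin m\varphi\\ \sin m\varphi&-\cos m\varphi\end{pmatrix}. \] Then every $V^\ell$ is irreducible and, for every $\ell\ge 0$ and each choice of sign, there are equivalences of real representations of $\mathrm{O}(2)$ \[ \operatorname{res}_{\mathrm{O}(2)}V^{2\ell\pm}\cong E^{0\pm}\oplus E^1\oplus\cdots\oplus E^{2\ell},\qquad \operatorname{res}_{\mathrm{O}(2)}V^{(2\ell+1)\pm}\cong E^{0\mp}\oplus E^1\oplus\cdots\oplus E^{2\ell+1}, \] with the signs corresponding (upper with upper, lower with lower). -/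

import Mathlib

open scoped TensorProduct

noncomputable section

namespace O3Restriction

/-- The group `O(2)` of real orthogonal `2 × 2` matrices. -/
abbrev O2 := Matrix.orthogonalGroup (Fin 2) ℝ

/-- The group `O(3)` of real orthogonal `3 × 3` matrices. -/
abbrev O3 := Matrix.orthogonalGroup (Fin 3) ℝ

/-- The group `SO(3)` of real orthogonal `3 × 3` matrices of determinant one. -/
abbrev SO3 := Matrix.specialOrthogonalGroup (Fin 3) ℝ

/-- The two signs `+` and `-` which label representations. -/
inductive Parity
  | plus
  | minus

/-- The opposite sign. -/
def Parity.opp : Parity → Parity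
  | .plus => .minus
  | .minus => .plus

/-- The one-dimensional real representation on `ℝ` given by a real character. -/
def charRep {G : Type*} [Monoid G] (χ : G →* ℝ) : Representation ℝ G ℝ where
  toFun g := χ g • LinearMap.id
  map_one' := by ext; simp
  map_mul' g h := by ext; simp [mul_comm]

/-- The determinant as a real character of the orthogonal group. -/
def detChar (n : ℕ) : Matrix.orthogonalGroup (Fin n) ℝ →* ℝ :=
  Matrix.detMonoidHom.comp (Matrix.orthogonalGroup (Fin n) ℝ).subtype

/-! ### The embedding of `O(2)` into `O(3)` -/

lemma block_mem (k : O2) :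
    !![k.1 0 0, k.1 0 1, 0; k.1 1 0, k.1 1 1, 0; 0, 0, 1] ∈
      Matrix.orthogonalGroup (Fin 3) ℝ := by
  have h := (Matrix.mem_orthogonalGroup_iff (Fin 2) ℝ).1 k.2
  have h00 := congrFun (congrFun h 0) 0
  have h01 := congrFun (congrFun h 0) 1
  have h10 := congrFun (congrFun h 1) 0
  have h11 := congrFun (congrFun h 1) 1
  simp [Matrix.mul_apply, Fin.sum_univ_two] at h00 h01 h10 h11
  rw [Matrix.mem_orthogonalGroup_iff]
  ext i j
  fin_cases i <;> fin_cases j <;>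
    simp [Matrix.mul_apply, Fin.sum_univ_three, h00, h01, h10, h11]

/-- The embedding of `O(2)` into `O(3)` as the upper-left block, with lower-right entry `1`. -/
def embO2 : O2 →* O3 where
  toFun k := ⟨!![k.1 0 0, k.1 0 1, 0; k.1 1 0, k.1 1 1, 0; 0, 0, 1], block_mem k⟩
  map_one' := by
    apply Subtype.ext
    ext i j
    fin_cases i <;> fin_cases j <;> simp
  map_mul' k l := by
    apply Subtype.ext
    ext i j
    fin_cases i <;> fin_cases j <;>
      simp [Matrix.mul_apply, Fin.sum_univ_two]

/-! ### The irreducible orthogonal representations of `O(2)` -/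

/-- The representations `E^{0+}` (trivial) and `E^{0-}` (determinant) of `O(2)`. -/
def E0 : Parity → Representation ℝ O2 ℝ
  | .plus => Representation.trivial ℝ O2 ℝ
  | .minus => charRep (detChar 2)

/-- The matrix of `E^m` at `k`. If `(a, b)` is the first column of `k` and
`u + v i = (a + b i)^m`, it is the matrix with first column `(u, v)` and second column
`det k • (-v, u)`. -/
def EMatrix (m : ℕ) (k : Matrix (Fin 2) (Fin 2) ℝ) : Matrix (Fin 2) (Fin 2) ℝ :=
  let z : ℂ := (⟨k 0 0, k 1 0⟩ : ℂ) ^ m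
  !![z.re, -(k.det * z.im); z.im, k.det * z.re]

/-- `E^m` sends the rotation by `φ` to the rotation by `m φ`. -/
lemma EMatrix_rotation (m : ℕ) (φ : ℝ) :
    EMatrix m !![Real.cos φ, -Real.sin φ; Real.sin φ, Real.cos φ] =
      !![Real.cos (m * φ), -Real.sin (m * φ); Real.sin (m * φ), Real.cos (m * φ)] := by
  have hz : (⟨Real.cos φ, Real.sin φ⟩ : ℂ) ^ m = ⟨Real.cos (m * φ), Real.sin (m * φ)⟩ := by
    have h1 : ∀ t : ℝ, (⟨Real.cos t, Real.sin t⟩ : ℂ) = Complex.exp (t * Complex.I) := by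
      intro t
      rw [Complex.exp_mul_I, ← Complex.ofReal_cos, ← Complex.ofReal_sin]
      apply Complex.ext <;> simp only [Complex.add_re, Complex.add_im, Complex.mul_re,
        Complex.mul_im, Complex.ofReal_re, Complex.ofReal_im, Complex.I_re, Complex.I_im] <;> ring
    rw [h1, h1, ← Complex.exp_nat_mul]
    push_cast
    ring_nf
  have hd : Real.cos φ * Real.cos φ + Real.sin φ * Real.sin φ = 1 := by
    nlinarith [Real.sin_sq_add_cos_sq φ]
  simp [EMatrix, hz, Matrix.det_fin_two, hd]

/-- `E^m` on the reflections of the plane. -/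
lemma EMatrix_reflection (m : ℕ) (φ : ℝ) :
    EMatrix m !![Real.cos φ, Real.sin φ; Real.sin φ, -Real.cos φ] =
      !![Real.cos (m * φ), Real.sin (m * φ); Real.sin (m * φ), -Real.cos (m * φ)] := by
  have hz : (⟨Real.cos φ, Real.sin φ⟩ : ℂ) ^ m = ⟨Real.cos (m * φ), Real.sin (m * φ)⟩ := by
    have h1 : ∀ t : ℝ, (⟨Real.cos t, Real.sin t⟩ : ℂ) = Complex.exp (t * Complex.I) := by
      intro t
      rw [Complex.exp_mul_I, ← Complex.ofReal_cos, ← Complex.ofReal_sin]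
      apply Complex.ext <;> simp only [Complex.add_re, Complex.add_im, Complex.mul_re,
        Complex.mul_im, Complex.ofReal_re, Complex.ofReal_im, Complex.I_re, Complex.I_im] <;> ring
    rw [h1, h1, ← Complex.exp_nat_mul]
    push_cast
    ring_nf
  have hd : -(Real.cos φ * Real.cos φ) - Real.sin φ * Real.sin φ = -1 := by
    nlinarith [Real.sin_sq_add_cos_sq φ]
  simp [EMatrix, hz, Matrix.det_fin_two, hd]

lemma O2_cases (k : O2) :
    (k.1.det = 1 ∧ k.1 0 1 = -k.1 1 0 ∧ k.1 1 1 = k.1 0 0) ∨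
      (k.1.det = -1 ∧ k.1 0 1 = k.1 1 0 ∧ k.1 1 1 = -k.1 0 0) := by
  have h := (Matrix.mem_orthogonalGroup_iff' (Fin 2) ℝ).1 k.2
  have hdet := congrArg Matrix.det h
  rw [Matrix.det_mul, Matrix.det_transpose, Matrix.det_one] at hdet
  have h00 := congrFun (congrFun h 0) 0
  have h01 := congrFun (congrFun h 0) 1
  simp [Matrix.mul_apply, Fin.sum_univ_two] at h00 h01
  have hd := Matrix.det_fin_two k.1
  rcases mul_self_eq_one_iff.1 hdet with h1 | h1
  · refine Or.inl ⟨h1, ?_, ?_⟩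
    · linear_combination (k.1 0 1) * -h00 + (k.1 0 0) * h01 - (k.1 1 0) * (h1.symm.trans hd).symm
    · linear_combination (k.1 1 1) * -h00 + (k.1 1 0) * h01 + (k.1 0 0) * (h1.symm.trans hd).symm
  · refine Or.inr ⟨h1, ?_, ?_⟩
    · linear_combination (k.1 0 1) * -h00 + (k.1 0 0) * h01 - (k.1 1 0) * (h1.symm.trans hd).symm
    · linear_combination (k.1 1 1) * -h00 + (k.1 1 0) * h01 + (k.1 0 0) * (h1.symm.trans hd).symm

lemma EMatrix_one (m : ℕ) : EMatrix m 1 = 1 := by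
  have hz : (⟨1, 0⟩ : ℂ) = 1 := rfl
  ext i j
  fin_cases i <;> fin_cases j <;> simp [EMatrix, hz]

lemma EMatrix_mul (m : ℕ) (k l : O2) :
    EMatrix m (k.1 * l.1) = EMatrix m k.1 * EMatrix m l.1 := by
  set w : ℂ := ⟨l.1 0 0, l.1 1 0⟩ with hw
  set z : ℂ := ⟨k.1 0 0, k.1 1 0⟩ with hz
  rcases O2_cases k with ⟨hd, h1, h2⟩ | ⟨hd, h1, h2⟩
  · have hzw : (⟨(k.1 * l.1) 0 0, (k.1 * l.1) 1 0⟩ : ℂ) = z * w := by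
      apply Complex.ext <;> simp [hw, hz, Matrix.mul_apply, Fin.sum_univ_two, h1, h2] <;> ring
    simp only [EMatrix, hzw, ← hz, ← hw, mul_pow, Matrix.det_mul, hd]
    ext i j
    fin_cases i <;> fin_cases j <;> simp [Matrix.mul_apply, Fin.sum_univ_two] <;> ring
  · have hzw : (⟨(k.1 * l.1) 0 0, (k.1 * l.1) 1 0⟩ : ℂ) = z * (starRingEnd ℂ) w := by
      apply Complex.ext <;> simp [hw, hz, Matrix.mul_apply, Fin.sum_univ_two, h1, h2] <;> ring
    have hc : (starRingEnd ℂ) w ^ m = (starRingEnd ℂ) (w ^ m) := (map_pow _ _ _).symm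
    simp only [EMatrix, hzw, ← hz, ← hw, mul_pow, Matrix.det_mul, hd, hc]
    ext i j
    fin_cases i <;> fin_cases j <;>
      simp [Matrix.mul_apply, Fin.sum_univ_two, -map_pow] <;> ring

/-- The representation `E^m` of `O(2)` on `ℝ²`. -/
def E (m : ℕ) : Representation ℝ O2 (Fin 2 → ℝ) where
  toFun k := Matrix.toLin' (EMatrix m k.1)
  map_one' := by
    change Matrix.toLin' (EMatrix m 1) = _
    rw [EMatrix_one, Matrix.toLin'_one]
    rfl
  map_mul' k l := by
    change Matrix.toLin' (EMatrix m (k.1 * l.1)) = _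
    rw [EMatrix_mul, Matrix.toLin'_mul]
    rfl

/-- The representation `E^{0±} ⊕ E^1 ⊕ ⋯ ⊕ E^n` of `O(2)`. -/
def sumE (s : Parity) (n : ℕ) :
    Representation ℝ O2 (ℝ × DirectSum (Fin n) fun _ => Fin 2 → ℝ) :=
  (E0 s).prod (Representation.directSum fun i : Fin n => E (i.1 + 1))

/-! ### The irreducible orthogonal representations of `SO(3)` -/

/-- Real polynomial functions on `ℝ³`. -/
abbrev Poly := MvPolynomial (Fin 3) ℝ

/-- The substitution `p(x) ↦ p(Aᵀ x)`. -/
def subst (A : Matrix (Fin 3) (Fin 3) ℝ) : Poly →ₐ[ℝ] Poly :=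
  MvPolynomial.aeval fun i => ∑ j, A j i • (MvPolynomial.X j : Poly)

/-- `SO(3)` acts on polynomial functions by `(g · p)(x) = p(g⁻¹ x)`, where `g⁻¹ = gᵀ`. -/
def polyRep : Representation ℝ SO3 Poly where
  toFun g := (subst g.1).toLinearMap
  map_one' := by
    have : subst 1 = AlgHom.id ℝ Poly := by
      apply MvPolynomial.algHom_ext
      intro i
      simp [subst, Matrix.one_apply]
    change (subst 1).toLinearMap = _
    rw [this]
    rfl
  map_mul' g h := by
    have : subst (g.1 * h.1) = (subst g.1).comp (subst h.1) := by
      apply MvPolynomial.algHom_ext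
      intro i
      simp only [subst, AlgHom.comp_apply, MvPolynomial.aeval_X, map_sum, map_smul,
        Matrix.mul_apply, Finset.sum_smul, Finset.smul_sum, smul_smul]
      rw [Finset.sum_comm]
      simp only [mul_comm]
    change (subst (g.1 * h.1)).toLinearMap = _
    rw [this]
    rfl

lemma eval_polyRep (g : SO3) (p : Poly) (x : Fin 3 → ℝ) :
    MvPolynomial.eval x (polyRep g p) = MvPolynomial.eval ((g⁻¹ : SO3).1.mulVec x) p := by
  change MvPolynomial.eval x (subst g.1 p) = _
  have h : ((MvPolynomial.aeval x).comp (subst g.1) : Poly →ₐ[ℝ] ℝ) =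
      MvPolynomial.aeval ((g⁻¹ : SO3).1.mulVec x) := by
    apply MvPolynomial.algHom_ext
    intro i
    have hi : (g⁻¹ : SO3).1 = (g.1).transpose := rfl
    simp [subst, hi, Matrix.mulVec, dotProduct]
  exact DFunLike.congr_fun h p

/-- The Laplace operator on polynomial functions. -/
def lap : Poly →ₗ[ℝ] Poly :=
  ∑ i : Fin 3, (MvPolynomial.pderiv i).toLinearMap ∘ₗ (MvPolynomial.pderiv i).toLinearMap

/-- Harmonic homogeneous polynomials of degree `ℓ` (the solid spherical harmonics). -/
def harmonic (ℓ : ℕ) : Submodule ℝ Poly :=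
  MvPolynomial.homogeneousSubmodule (Fin 3) ℝ ℓ ⊓ LinearMap.ker lap

lemma pderiv_subst (A : Matrix (Fin 3) (Fin 3) ℝ) (j : Fin 3) (p : Poly) :
    MvPolynomial.pderiv j (subst A p) =
      ∑ i, A j i • subst A (MvPolynomial.pderiv i p) := by
  induction p using MvPolynomial.induction_on with
  | C a => simp [subst]
  | add p q hp hq => simp [hp, hq, Finset.sum_add_distrib]
  | mul_X p k hp =>
    have hk : MvPolynomial.pderiv j (subst A (MvPolynomial.X k)) =
        MvPolynomial.C (A j k) := by
      simp [subst, MvPolynomial.pderiv_X, Pi.single_apply, MvPolynomial.smul_eq_C_mul]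
    have hX : ∀ i, subst A (MvPolynomial.pderiv i (MvPolynomial.X k)) =
        if i = k then 1 else 0 := by
      intro i
      by_cases h : i = k
      · subst h
        simp
      · simp [MvPolynomial.pderiv_X, h]
    simp only [map_mul, Derivation.leibniz, hp, hk, map_add, smul_eq_mul, hX,
      MvPolynomial.smul_eq_C_mul, mul_add, Finset.sum_add_distrib, Finset.mul_sum, mul_ite,
      mul_one, mul_zero, Finset.sum_ite_eq', Finset.mem_univ, if_true]
    refine congrArg₂ _ (by ring) (Finset.sum_congr rfl fun _ _ => by ring)

lemma lap_subst (g : SO3) (p : Poly) : lap (subst g.1 p) = subst g.1 (lap p) := by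
  have h := (Matrix.mem_orthogonalGroup_iff' (Fin 3) ℝ).1
    (Matrix.mem_specialOrthogonalGroup_iff.1 g.2).1
  simp only [lap, LinearMap.sum_apply, LinearMap.comp_apply, Derivation.coeFn_coe,
    pderiv_subst, map_sum, map_smul, Finset.smul_sum, smul_smul]
  rw [Finset.sum_comm]
  refine Finset.sum_congr rfl fun i _ => ?_
  rw [Finset.sum_comm]
  simp only [← Finset.sum_smul]
  have key : ∀ i' : Fin 3, ∑ j, g.1 j i * g.1 j i' = if i = i' then 1 else 0 := by
    intro i'
    have := congrFun (congrFun h i) i'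
    simpa [Matrix.mul_apply, Matrix.one_apply] using this
  simp [key]

lemma subst_homogeneous (A : Matrix (Fin 3) (Fin 3) ℝ) {n : ℕ} {p : Poly}
    (hp : p.IsHomogeneous n) : (subst A p).IsHomogeneous n := by
  have h := hp.aeval (fun i => ∑ j, A j i • (MvPolynomial.X j : Poly)) (n := 1) (fun i => by
    refine MvPolynomial.IsHomogeneous.sum _ _ _ fun j _ => ?_
    rw [MvPolynomial.smul_eq_C_mul]
    exact (MvPolynomial.isHomogeneous_X ℝ j).C_mul _)
  simpa [subst] using h

/-- The representation `V^ℓ` of `SO(3)`, on the harmonic homogeneous polynomials of degree `ℓ`. -/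
def VSO3 (ℓ : ℕ) : Representation ℝ SO3 (harmonic ℓ) :=
  polyRep.subrepresentation (harmonic ℓ) fun g p hp => by
    refine ⟨?_, ?_⟩
    · exact subst_homogeneous g.1 hp.1
    · change lap (subst g.1 p) = 0
      rw [lap_subst, LinearMap.mem_ker.1 hp.2, map_zero]

/-! ### The representations of `O(3) = SO(3) × {±e}` -/

/-- The subgroup `{e, -e}` of `O(3)`. -/
def Z2c : Subgroup O3 where
  carrier := {z | z.1 = 1 ∨ z.1 = -1}
  one_mem' := Or.inl rfl
  mul_mem' := by
    rintro a b (ha | ha) (hb | hb)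
    · exact Or.inl (by change a.1 * b.1 = 1; simp [ha, hb])
    · exact Or.inr (by change a.1 * b.1 = -1; simp [ha, hb])
    · exact Or.inr (by change a.1 * b.1 = -1; simp [ha, hb])
    · exact Or.inl (by change a.1 * b.1 = 1; simp [ha, hb])
  inv_mem' := by
    rintro a (ha | ha)
    · left
      change star a.1 = 1
      rw [ha, star_one]
    · right
      change star a.1 = -1
      rw [ha, star_neg, star_one]

lemma Z2c_comm (z : Z2c) (B : Matrix (Fin 3) (Fin 3) ℝ) : z.1.1 * B = B * z.1.1 := by
  rcases z.2 with h | h <;> simp [h]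

/-- Multiplication `SO(3) × {±e} → O(3)` as a group homomorphism. -/
def prodHom : SO3 × Z2c →* O3 where
  toFun x := ⟨x.1.1, (Matrix.mem_specialOrthogonalGroup_iff.1 x.1.2).1⟩ * x.2.1
  map_one' := by
    apply Subtype.ext
    simp
  map_mul' x y := by
    apply Subtype.ext
    change (x.1.1 * y.1.1) * (x.2.1.1 * y.2.1.1) = (x.1.1 * x.2.1.1) * (y.1.1 * y.2.1.1)
    have h := Z2c_comm x.2 y.1.1
    simp only [mul_assoc]
    rw [← mul_assoc y.1.1, ← h, mul_assoc]

lemma det_O3 (A : O3) : A.1.det = 1 ∨ A.1.det = -1 := by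
  have h := congrArg Matrix.det ((Matrix.mem_orthogonalGroup_iff (Fin 3) ℝ).1 A.2)
  rw [Matrix.det_mul, Matrix.det_transpose, Matrix.det_one] at h
  exact mul_self_eq_one_iff.1 h

lemma neg_one_mem_O3 : (-1 : Matrix (Fin 3) (Fin 3) ℝ) ∈ Matrix.orthogonalGroup (Fin 3) ℝ := by
  rw [Matrix.mem_orthogonalGroup_iff]
  simp

lemma prodHom_bijective : Function.Bijective prodHom := by
  constructor
  · rw [injective_iff_map_eq_one]
    rintro ⟨g, z⟩ h
    have h1 : g.1 * z.1.1 = 1 := congrArg Subtype.val h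
    have hg := (Matrix.mem_specialOrthogonalGroup_iff.1 g.2).2
    rcases z.2 with hz | hz
    · refine Prod.ext (Subtype.ext ?_) (Subtype.ext (Subtype.ext hz))
      simpa [hz] using h1
    · have h2 := congrArg Matrix.det h1
      rw [Matrix.det_mul, hg, hz, Matrix.det_neg, Matrix.det_one] at h2
      norm_num at h2
  · intro A
    rcases det_O3 A with h | h
    · refine ⟨(⟨A.1, Matrix.mem_specialOrthogonalGroup_iff.2 ⟨A.2, h⟩⟩, 1), ?_⟩
      apply Subtype.ext
      change A.1 * 1 = A.1
      rw [mul_one]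
    · have hm : -A.1 ∈ Matrix.specialOrthogonalGroup (Fin 3) ℝ := by
        refine Matrix.mem_specialOrthogonalGroup_iff.2 ⟨?_, ?_⟩
        · rw [Matrix.mem_orthogonalGroup_iff]
          simpa using (Matrix.mem_orthogonalGroup_iff (Fin 3) ℝ).1 A.2
        · rw [Matrix.det_neg, h]
          norm_num
      refine ⟨(⟨-A.1, hm⟩, ⟨⟨-1, neg_one_mem_O3⟩, Or.inr rfl⟩), ?_⟩
      apply Subtype.ext
      change -A.1 * -1 = A.1
      simp

/-- The decomposition `SO(3) × {±e} ≃ O(3)`, `(g, z) ↦ g z`. -/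
def prodEquiv : SO3 × Z2c ≃* O3 := MulEquiv.ofBijective prodHom prodHom_bijective

/-- The representations `V^+` (trivial) and `V^-` (determinant) of `{±e}`. -/
def VZ : Parity → Representation ℝ Z2c ℝ
  | .plus => Representation.trivial ℝ Z2c ℝ
  | .minus => charRep ((detChar 3).comp Z2c.subtype)

/-- The representation `V^{ℓ±} = V^ℓ ⊗ V^±` of `O(3) = SO(3) × {±e}`: if `A = g z`, then
`A · (v ⊗ w) = (g · v) ⊗ (z · w)`. -/
def VO3 (ℓ : ℕ) (s : Parity) : Representation ℝ O3 (harmonic ℓ ⊗[ℝ] ℝ) :=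
  MonoidHom.comp
    (Representation.tprod (G := SO3 × Z2c) ((VSO3 ℓ).comp (MonoidHom.fst SO3 Z2c))
      ((VZ s).comp (MonoidHom.snd SO3 Z2c)))
    prodEquiv.symm.toMonoidHom

/-- The restriction of a representation of `O(3)` to `O(2)`. -/
def resO2 {V : Type*} [AddCommMonoid V] [Module ℝ V] (ρ : Representation ℝ O3 V) :
    Representation ℝ O2 V :=
  ρ.comp embO2

end O3Restriction

end

namespace O3Restriction
open MvPolynomial

/-! ### Planar harmonic polynomials -/

/-! Branching. Harmonic polynomials of degree `ℓ` have a basis adapted to the third axis: a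
rotation-invariant factor in `x² + y²` and `z`, times the real or imaginary part of `(x + iy)^m`, `0
≤ m ≤ ℓ`. Under the geometric action of `O(2)` the part of weight `m ≥ 1` is `E^m` and the part of
weight `0` is fixed. The solid harmonics are independent because their weights are separated by the
eigenvalues `-m²` of the squared angular derivative (`solidSum_injective`). They span because a
harmonic polynomial is determined by its terms of degree at most one in `z`, so that the dimension
is at most `2ℓ + 1` (`finrank_harmonic_le`).

Signs. A reflection `k` embeds in `O(3)` with determinant `-1`, so it factors as `g · (-e)` with `g
= -k`. On degree `ℓ` this differs from the geometric action by `(-1)^ℓ` times the sign of `V^±`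
(`resO2_VO3_tmul`). The resulting character of `O(2)` changes `E^{0+}` into `E^{0±}` and leaves
`E^m` unchanged up to equivalence (`twist_E`).

Irreducibility. Every nonzero invariant subspace contains the zonal harmonic: rotate an element
until it is nonzero at the pole, then average it over a finite group of rotations about the axis
(`zonal_mem`). An invariant subspace and its orthogonal complement for the invariant `L²` form on
the ball cannot both contain it. -/

lemma pderiv_pderiv_comm (i j : Fin 3) (p : Poly) :
    pderiv i (pderiv j p) = pderiv j (pderiv i p) := by
  -- The commutator of two derivations is a derivation, so it vanishes once it kills the variables.
  have h : ⁅pderiv (R := ℝ) i, pderiv j⁆ = (0 : Derivation ℝ Poly Poly) := by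
    apply MvPolynomial.derivation_ext
    intro k
    simp [Derivation.commutator_apply, pderiv_X, Pi.single_apply, apply_ite]
  have := DFunLike.congr_fun h p
  rwa [Derivation.commutator_apply, Derivation.coe_zero, Pi.zero_apply, sub_eq_zero] at this

lemma lap_apply (p : Poly) :
    lap p = pderiv 0 (pderiv 0 p) + pderiv 1 (pderiv 1 p) + pderiv 2 (pderiv 2 p) := by
  simp [lap, Fin.sum_univ_three]

/-- The real and imaginary parts of `(x + i y)^m`. -/
noncomputable def planarPair : ℕ → Poly × Poly
  | 0 => (1, 0)
  | m + 1 => (X 0 * (planarPair m).1 - X 1 * (planarPair m).2,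
      X 0 * (planarPair m).2 + X 1 * (planarPair m).1)

/-- The infinitesimal rotation about the third axis. -/
noncomputable def angular : Poly →ₗ[ℝ] Poly :=
  ((X 0 : Poly) • pderiv 1 - (X 1 : Poly) • pderiv 0 : Derivation ℝ Poly Poly).toLinearMap

lemma angular_apply (p : Poly) : angular p = X 0 * pderiv 1 p - X 1 * pderiv 0 p := rfl

lemma angular_mul (p q : Poly) : angular (p * q) = p * angular q + q * angular p := by
  simp only [angular_apply, Derivation.leibniz, smul_eq_mul]
  ring

/-- This is `∂_φ (x + iy)^m = i m (x + iy)^m`, split into real and imaginary parts. -/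
lemma angular_planarPair (m : ℕ) : angular (planarPair m).1 = -(m : Poly) * (planarPair m).2 ∧
    angular (planarPair m).2 = (m : Poly) * (planarPair m).1 := by
  induction m with
  | zero => simp [planarPair, angular_apply]
  | succ m ih =>
    obtain ⟨h1, h2⟩ := ih
    have hx : angular (X 0) = -X 1 := by simp [angular_apply, pderiv_X]
    have hy : angular (X 1) = X 0 := by simp [angular_apply, pderiv_X]
    constructor <;>
    · simp only [planarPair, map_add, map_sub, angular_mul, h1, h2, hx, hy]
      push_cast
      ring

lemma euler_planarPair (m : ℕ) :
    X 0 * pderiv 0 (planarPair m).1 + X 1 * pderiv 1 (planarPair m).1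
      = (m : Poly) * (planarPair m).1 ∧
    X 0 * pderiv 0 (planarPair m).2 + X 1 * pderiv 1 (planarPair m).2
      = (m : Poly) * (planarPair m).2 := by
  induction m with
  | zero => simp [planarPair]
  | succ m ih =>
    obtain ⟨h1, h2⟩ := ih
    constructor
    · simp [planarPair, pderiv_X, Derivation.leibniz]
      linear_combination X 0 * h1 - X 1 * h2
    · simp [planarPair, pderiv_X, Derivation.leibniz]
      linear_combination X 0 * h2 + X 1 * h1

lemma cauchyRiemann_planarPair (m : ℕ) :
    pderiv 1 (planarPair m).1 = -pderiv 0 (planarPair m).2 ∧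
    pderiv 1 (planarPair m).2 = pderiv 0 (planarPair m).1 := by
  induction m with
  | zero => simp [planarPair]
  | succ m ih =>
    obtain ⟨h1, h2⟩ := ih
    constructor <;>
    · simp [planarPair, pderiv_X, Derivation.leibniz, h1, h2]
      ring

lemma pderiv_two_planarPair (m : ℕ) :
    pderiv 2 (planarPair m).1 = 0 ∧ pderiv 2 (planarPair m).2 = 0 := by
  induction m with
  | zero => simp [planarPair]
  | succ m ih => simp [planarPair, pderiv_X, Derivation.leibniz, ih]

lemma planarPair_homogeneous (m : ℕ) :
    (planarPair m).1.IsHomogeneous m ∧ (planarPair m).2.IsHomogeneous m := by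
  induction m with
  | zero => exact ⟨isHomogeneous_one _ _, isHomogeneous_zero _ _ _⟩
  | succ m ih =>
    -- The degree must read `1 + m` to match a product with a variable, while `planarPair` unfolds
    -- only at `m + 1`.
    rw [add_comm m 1]
    rw [show planarPair (1 + m) = planarPair (m + 1) by rw [add_comm]]
    exact ⟨((isHomogeneous_X ℝ 0).mul ih.1).sub ((isHomogeneous_X ℝ 1).mul ih.2),
      ((isHomogeneous_X ℝ 0).mul ih.2).add ((isHomogeneous_X ℝ 1).mul ih.1)⟩

lemma eval_planarPair_x (m : ℕ) :
    eval ![1, 0, 0] (planarPair m).1 = 1 ∧ eval ![1, 0, 0] (planarPair m).2 = 0 := by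
  induction m with
  | zero => simp [planarPair]
  | succ m ih => simp [planarPair, ih]

/-- The real linear combinations of the real and imaginary parts of `(x + i y)^m`. -/
noncomputable def planar (m : ℕ) : (Fin 2 → ℝ) →ₗ[ℝ] Poly where
  toFun v := v 0 • (planarPair m).1 + v 1 • (planarPair m).2
  map_add' v w := by simp only [Pi.add_apply, add_smul]; abel
  map_smul' c v := by simp only [Pi.smul_apply, smul_eq_mul, mul_smul, smul_add, RingHom.id_apply]

lemma planar_apply (m : ℕ) (v : Fin 2 → ℝ) :
    planar m v = v 0 • (planarPair m).1 + v 1 • (planarPair m).2 := rfl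

lemma euler_planar (m : ℕ) (v : Fin 2 → ℝ) :
    X 0 * pderiv 0 (planar m v) + X 1 * pderiv 1 (planar m v) = (m : Poly) * planar m v := by
  obtain ⟨h1, h2⟩ := euler_planarPair m
  simp only [planar_apply, map_add, Derivation.map_smul]
  simp only [smul_eq_C_mul]
  linear_combination C (v 0) * h1 + C (v 1) * h2

lemma pderiv_two_planar (m : ℕ) (v : Fin 2 → ℝ) : pderiv 2 (planar m v) = 0 := by
  simp [planar_apply, pderiv_two_planarPair]

lemma lap_planar (m : ℕ) (v : Fin 2 → ℝ) : lap (planar m v) = 0 := by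
  obtain ⟨h1, h2⟩ := cauchyRiemann_planarPair m
  rw [lap_apply, pderiv_two_planar, map_zero, add_zero]
  simp only [planar_apply, map_add, Derivation.map_smul, h1, h2, map_neg, pderiv_pderiv_comm 1 0, smul_neg]
  abel

lemma planar_homogeneous (m : ℕ) (v : Fin 2 → ℝ) : (planar m v).IsHomogeneous m :=
  ((homogeneousSubmodule (Fin 3) ℝ m).smul_mem _ (planarPair_homogeneous m).1).add
    ((homogeneousSubmodule (Fin 3) ℝ m).smul_mem _ (planarPair_homogeneous m).2)

lemma angular_angular_planar (m : ℕ) (v : Fin 2 → ℝ) :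
    angular (angular (planar m v)) = (-(m : ℝ) ^ 2) • planar m v := by
  obtain ⟨h1, h2⟩ := angular_planarPair m
  have e : (m : Poly) = C (m : ℝ) := by simp
  rw [e] at h1 h2
  simp only [← C_neg, ← smul_eq_C_mul] at h1 h2
  simp only [planar_apply, map_add, map_smul, h1, h2, smul_smul, smul_add]
  congr 2 <;> ring

lemma planar_injective (m : ℕ) (hm : m ≠ 0) : Function.Injective (planar m) := by
  rw [injective_iff_map_eq_zero]
  intro v hv
  obtain ⟨h1, h2⟩ := angular_planarPair m
  -- At `(1, 0, 0)` the polynomial itself reads off `v 0`, and its angular derivative reads off `m *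
  -- v 1`.
  have ha : angular (planar m v) = 0 := by rw [hv, map_zero]
  simp only [planar_apply, map_add, map_smul, h1, h2] at ha
  have e0 := congrArg (eval ![1, 0, 0]) hv
  have e1 := congrArg (eval ![1, 0, 0]) ha
  simp [planar_apply, eval_planarPair_x, smul_eval, hm] at e0 e1
  ext i
  fin_cases i <;> simp [e0, e1]

/-! ### Solid harmonics -/

/-- The polynomial `x² + y²`. -/
noncomputable def rho : Poly := X 0 ^ 2 + X 1 ^ 2

/-- The coefficients of the factor of a solid harmonic which depends on `x² + y²` and `z`. -/
noncomputable def solidCoeff (n m : ℕ) : ℕ → ℝ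
  | 0 => 1
  | j + 1 => -(((n - 2 * j : ℕ) : ℝ) * ((n - 2 * j - 1 : ℕ) : ℝ)) /
      (4 * ((j : ℝ) + 1) * ((j : ℝ) + 1 + m)) * solidCoeff n m j

/-- The recursion stops by itself: one of its truncated factors `n - 2j`, `n - 2j - 1` vanishes when
the next exponent of `z` would be negative. Hence the surplus terms of `solidFactor` are harmless.
-/
lemma solidCoeff_eq_zero (n m j : ℕ) (h : n < 2 * j) : solidCoeff n m j = 0 := by
  cases j with
  | zero => omega
  | succ j =>
    have : n - 2 * j = 0 ∨ n - 2 * j - 1 = 0 := by omega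
    rcases this with h | h <;> simp [solidCoeff, h]

/-- The factor of a solid harmonic of degree `n + m` which depends on `x² + y²` and `z`. -/
noncomputable def solidFactor (n m : ℕ) : Poly :=
  ∑ j ∈ Finset.range (n + 1), C (solidCoeff n m j) * (rho ^ j * X 2 ^ (n - 2 * j))

lemma rho_homogeneous : rho.IsHomogeneous 2 :=
  ((isHomogeneous_X_pow (R := ℝ) 0 2)).add (isHomogeneous_X_pow (R := ℝ) 1 2)

lemma solidFactor_homogeneous (n m : ℕ) : (solidFactor n m).IsHomogeneous n := by
  refine IsHomogeneous.sum _ _ _ fun j _ => ?_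
  by_cases h : n < 2 * j
  · rw [solidCoeff_eq_zero n m j h, C_0, zero_mul]
    exact isHomogeneous_zero _ _ _
  · have := ((rho_homogeneous.pow j).mul (isHomogeneous_X_pow (R := ℝ) (2 : Fin 3) (n - 2 * j)))
    rw [show 2 * j + (n - 2 * j) = n by omega] at this
    exact this.C_mul _

lemma eval_solidFactor (n m : ℕ) : eval ![0, 0, 1] (solidFactor n m) = 1 := by
  rw [solidFactor, map_sum, Finset.sum_eq_single 0]
  · simp [solidCoeff]
  · intro j _ hj
    simp [rho, hj]
  · simp

lemma solidFactor_ne_zero (n m : ℕ) : solidFactor n m ≠ 0 := by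
  intro h
  have := eval_solidFactor n m
  simp [h] at this

lemma angular_solidFactor (n m : ℕ) : angular (solidFactor n m) = 0 := by
  rw [solidFactor, map_sum]
  refine Finset.sum_eq_zero fun j _ => ?_
  have h : angular rho = 0 := by
    simp [angular_apply, rho, pderiv_X, Derivation.leibniz_pow]
    ring
  simp only [angular_apply] at h ⊢
  simp [Derivation.leibniz, Derivation.leibniz_pow, pderiv_X]
  linear_combination C (solidCoeff n m j) * X 2 ^ (n - 2 * j) * (j : Poly) * rho ^ (j - 1) * h

/-- In the plane `Δ(ρ^j) = 4j² ρ^(j-1)`, and by Euler's identity the cross term `2∇ρ^j · ∇P`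
contributes `4jm ρ^(j-1) P`; `P` itself is harmonic. The truncated exponents only occur with a zero
coefficient. -/
lemma lap_rho_pow_mul (m j k : ℕ) (v : Fin 2 → ℝ) :
    lap (rho ^ j * X 2 ^ k * planar m v) =
      4 * (j : Poly) * ((j : Poly) + (m : Poly)) * (rho ^ (j - 1) * X 2 ^ k * planar m v) +
      (k : Poly) * ((k - 1 : ℕ) : Poly) * (rho ^ j * X 2 ^ (k - 2) * planar m v) := by
  have h0 := euler_planar m v
  have h1 := lap_planar m v
  have h2 := pderiv_two_planar m v
  rw [lap_apply, h2, map_zero, add_zero] at h1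
  have r0 : pderiv 0 rho = 2 * X 0 := by simp [rho, pderiv_X, Derivation.leibniz_pow]
  have r1 : pderiv 1 rho = 2 * X 1 := by simp [rho, pderiv_X, Derivation.leibniz_pow]
  have r2 : pderiv 2 rho = 0 := by simp [rho, pderiv_X, Derivation.leibniz_pow]
  have two : ∀ i, pderiv i (2 : Poly) = 0 := fun i => by
    simpa using (pderiv i).map_natCast (A := Poly) 2
  rw [lap_apply]
  simp [Derivation.leibniz, Derivation.leibniz_pow, r0, r1, r2, h2, pderiv_X, two]
  have hr : (j : Poly) * ((j - 1 : ℕ) : Poly) * (rho ^ (j - 1 - 1) * (X 0 ^ 2 + X 1 ^ 2))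
      = (j : Poly) * ((j : Poly) - 1) * rho ^ (j - 1) := by
    rcases j with _ | _ | j
    · simp
    · simp
    · simp only [rho, Nat.add_sub_cancel]
      push_cast
      ring
  have hk : k - 1 - 1 = k - 2 := by omega
  rw [hk]
  linear_combination 4 * X 2 ^ k * planar m v * hr + rho ^ j * X 2 ^ k * h1 +
    4 * (j : Poly) * rho ^ (j - 1) * X 2 ^ k * h0

lemma lap_solid (n m : ℕ) (v : Fin 2 → ℝ) : lap (solidFactor n m * planar m v) = 0 := by
  -- The recursion for `solidCoeff` makes the sum telescope. The lower end vanishes through the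
  -- factor `j`, the upper end through `solidCoeff_eq_zero`.
  have hterm : ∀ j, lap (C (solidCoeff n m j) * (rho ^ j * X 2 ^ (n - 2 * j)) * planar m v) =
      C (solidCoeff n m j * (4 * j * (j + m))) *
        (rho ^ (j - 1) * X 2 ^ (n - 2 * j) * planar m v) -
      C (solidCoeff n m (j + 1) * (4 * (j + 1 : ℕ) * ((j + 1 : ℕ) + m))) *
        (rho ^ (j + 1 - 1) * X 2 ^ (n - 2 * (j + 1)) * planar m v) := by
    intro j
    have hc : solidCoeff n m (j + 1) * (4 * (j + 1 : ℕ) * ((j + 1 : ℕ) + m)) =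
        -(((n - 2 * j : ℕ) : ℝ) * ((n - 2 * j - 1 : ℕ) : ℝ)) * solidCoeff n m j := by
      have h1 : (j : ℝ) + 1 ≠ 0 := by positivity
      have h2 : (j : ℝ) + 1 + m ≠ 0 := by positivity
      rw [solidCoeff]
      push_cast
      field_simp
    rw [hc, mul_assoc, ← smul_eq_C_mul, map_smul, lap_rho_pow_mul, smul_eq_C_mul,
      show n - 2 * j - 2 = n - 2 * (j + 1) by omega]
    have h4 : (C 4 : Poly) = 4 := map_ofNat C 4
    simp [h4]
    ring
  rw [solidFactor, Finset.sum_mul, map_sum, Finset.sum_congr rfl fun j _ => hterm j,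
    Finset.sum_range_sub']
  rw [solidCoeff_eq_zero n m (n + 1) (by omega)]
  simp

lemma solid_mem_harmonic (n m : ℕ) (v : Fin 2 → ℝ) :
    solidFactor n m * planar m v ∈ harmonic (n + m) :=
  ⟨(solidFactor_homogeneous n m).mul (planar_homogeneous m v), lap_solid n m v⟩

/-! ### The action of `O(2)` on solid harmonics -/

lemma subst_embO2_X (k : O2) :
    subst (embO2 k).1 (X 0) = C (k.1 0 0) * X 0 + C (k.1 1 0) * X 1 ∧
    subst (embO2 k).1 (X 1) = C (k.1 0 1) * X 0 + C (k.1 1 1) * X 1 ∧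
    subst (embO2 k).1 (X 2) = X 2 := by
  simp [subst, embO2, Fin.sum_univ_three, smul_eq_C_mul]

lemma O2_det_form (k : O2) : k.1.det ^ 2 = 1 ∧ k.1 0 1 = -(k.1.det * k.1 1 0) ∧
    k.1 1 1 = k.1.det * k.1 0 0 ∧ k.1 0 0 ^ 2 + k.1 1 0 ^ 2 = 1 := by
  have hd := Matrix.det_fin_two k.1
  rcases O2_cases k with ⟨h, h1, h2⟩ | ⟨h, h1, h2⟩ <;> rw [h, h1, h2] at hd <;>
    refine ⟨by rw [h]; norm_num, by rw [h, h1]; ring, by rw [h, h2]; ring, by linarith⟩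

lemma subst_rho (k : O2) : subst (embO2 k).1 rho = rho := by
  obtain ⟨h0, h1, -⟩ := subst_embO2_X k
  obtain ⟨hd, h2, h3, h4⟩ := O2_det_form k
  have hd' := congrArg (C (σ := Fin 3)) hd
  have h4' := congrArg (C (σ := Fin 3)) h4
  simp only [map_add, map_pow, map_one] at hd' h4'
  simp only [rho, map_add, map_pow, h0, h1, h2, h3, map_neg, map_mul]
  linear_combination (X 0 ^ 2 + X 1 ^ 2) * h4' +
    (C (k.1 1 0) * X 0 - C (k.1 0 0) * X 1) ^ 2 * hd'

lemma subst_solidFactor (k : O2) (n m : ℕ) :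
    subst (embO2 k).1 (solidFactor n m) = solidFactor n m := by
  have hC : ∀ c : ℝ, subst (embO2 k).1 (C c) = C c := fun c => by simp [subst]
  simp only [solidFactor, map_sum, map_mul, map_pow, subst_rho, hC, (subst_embO2_X k).2.2]

/-- Let `ζ` be the first column of `k` as a complex number. The substitution sends `x + iy` to `conj
ζ (x + iy)` for a rotation and to `ζ (x - iy)` for a reflection; the formulas are the `m`-th powers.
-/
lemma subst_planarPair (k : O2) (m : ℕ) :
    subst (embO2 k).1 (planarPair m).1 = C (((⟨k.1 0 0, k.1 1 0⟩ : ℂ) ^ m).re) * (planarPair m).1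
      + C (((⟨k.1 0 0, k.1 1 0⟩ : ℂ) ^ m).im) * (planarPair m).2 ∧
    subst (embO2 k).1 (planarPair m).2 = C k.1.det *
      (C (((⟨k.1 0 0, k.1 1 0⟩ : ℂ) ^ m).re) * (planarPair m).2
      - C (((⟨k.1 0 0, k.1 1 0⟩ : ℂ) ^ m).im) * (planarPair m).1) := by
  obtain ⟨h0, h1, -⟩ := subst_embO2_X k
  obtain ⟨hd, h2, h3, -⟩ := O2_det_form k
  have hd' := congrArg (C (σ := Fin 3)) hd
  simp only [map_pow, map_one] at hd'
  induction m with
  | zero => simp [planarPair]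
  | succ m ih =>
    obtain ⟨i1, i2⟩ := ih
    simp only [planarPair, map_add, map_sub, map_mul, h0, h1, i1, i2, h2, h3, pow_succ,
      Complex.mul_re, Complex.mul_im, map_neg]
    generalize ((⟨k.1 0 0, k.1 1 0⟩ : ℂ) ^ m).re = u
    generalize ((⟨k.1 0 0, k.1 1 0⟩ : ℂ) ^ m).im = w
    constructor
    · linear_combination (C (k.1 1 0) * X 0 - C (k.1 0 0) * X 1) *
        (C u * (planarPair m).2 - C w * (planarPair m).1) * hd'
    · ring

lemma subst_planar (k : O2) (m : ℕ) (v : Fin 2 → ℝ) :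
    subst (embO2 k).1 (planar m v) = planar m (E m k v) := by
  obtain ⟨h1, h2⟩ := subst_planarPair k m
  have e0 : E m k v 0 = ((⟨k.1 0 0, k.1 1 0⟩ : ℂ) ^ m).re * v 0 -
      k.1.det * ((⟨k.1 0 0, k.1 1 0⟩ : ℂ) ^ m).im * v 1 := by
    simp [E, EMatrix, Matrix.mulVec, dotProduct, Fin.sum_univ_two]
    ring
  have e1 : E m k v 1 = ((⟨k.1 0 0, k.1 1 0⟩ : ℂ) ^ m).im * v 0 +
      k.1.det * ((⟨k.1 0 0, k.1 1 0⟩ : ℂ) ^ m).re * v 1 := by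
    simp [E, EMatrix, Matrix.mulVec, dotProduct, Fin.sum_univ_two]
  simp only [planar_apply, map_add, map_smul, h1, h2, e0, e1]
  simp only [smul_eq_C_mul, map_add, map_sub, map_mul]
  ring

/-- The character of `O(2)` by which `E^{0±}` acts. -/
noncomputable def chi : Parity → O2 → ℝ
  | .plus, _ => 1
  | .minus, k => k.1.det

lemma E0_apply (t : Parity) (k : O2) (c : ℝ) : E0 t k c = chi t k * c := by
  cases t
  · simp [E0, chi]
  · rfl

/-- A self-equivalence `E^m ⊗ E^{0±} ≅ E^m`. -/
noncomputable def twist : Parity → (Fin 2 → ℝ) →ₗ[ℝ] (Fin 2 → ℝ)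
  | .plus => LinearMap.id
  | .minus => Matrix.toLin' !![0, -1; 1, 0]

lemma twist_injective (t : Parity) : Function.Injective (twist t) := by
  cases t
  · exact Function.injective_id
  · rw [injective_iff_map_eq_zero]
    intro v hv
    have h0 := congrFun hv 0
    have h1 := congrFun hv 1
    simp [twist, Matrix.mulVec, dotProduct, Fin.sum_univ_two] at h0 h1
    ext i
    fin_cases i <;> simp [h0, h1]

/-- A quarter turn commutes with rotations and anticommutes with reflections, so it absorbs the
determinant. -/
lemma twist_E (t : Parity) (m : ℕ) (k : O2) (v : Fin 2 → ℝ) :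
    twist t (E m k v) = chi t k • E m k (twist t v) := by
  cases t
  · simp [twist, chi]
  · have hd := (O2_det_form k).1
    ext i
    fin_cases i <;>
      simp [twist, chi, E, EMatrix, Matrix.mulVec, dotProduct, Fin.sum_univ_two]
    · linear_combination v 0 * ((⟨k.1 0 0, k.1 1 0⟩ : ℂ) ^ m).im * hd
    · linear_combination -(v 0 * ((⟨k.1 0 0, k.1 1 0⟩ : ℂ) ^ m).re) * hd

/-- The map sending `(c, v₁, …, v_ℓ)` to the sum of the corresponding solid harmonics. -/
noncomputable def solidSum (t : Parity) (ℓ : ℕ) :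
    (ℝ × DirectSum (Fin ℓ) fun _ => Fin 2 → ℝ) →ₗ[ℝ] Poly :=
  (LinearMap.toSpanSingleton ℝ Poly (solidFactor ℓ 0)).coprod
    (DirectSum.toModule ℝ (Fin ℓ) Poly fun i =>
      LinearMap.mulLeft ℝ (solidFactor (ℓ - (i.1 + 1)) (i.1 + 1)) ∘ₗ planar (i.1 + 1) ∘ₗ twist t)

lemma solidSum_apply (t : Parity) (ℓ : ℕ) (x : ℝ × DirectSum (Fin ℓ) fun _ => Fin 2 → ℝ) :
    solidSum t ℓ x = x.1 • solidFactor ℓ 0 + ∑ i : Fin ℓ,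
      solidFactor (ℓ - (i.1 + 1)) (i.1 + 1) * planar (i.1 + 1) (twist t (x.2 i)) := by
  obtain ⟨c, v⟩ := x
  simp only [solidSum, LinearMap.coprod_apply, LinearMap.toSpanSingleton_apply]
  congr 1
  conv_lhs => rw [← DirectSum.sum_univ_of v, map_sum]
  refine Finset.sum_congr rfl fun i _ => ?_
  rw [← DirectSum.lof_eq_of ℝ, DirectSum.toModule_lof]
  rfl

lemma solidFactor_mem_harmonic (ℓ : ℕ) : solidFactor ℓ 0 ∈ harmonic ℓ := by
  have := solid_mem_harmonic ℓ 0 ![1, 0]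
  simpa [planar_apply, planarPair] using this

lemma solidSum_mem_harmonic (t : Parity) (ℓ : ℕ)
    (x : ℝ × DirectSum (Fin ℓ) fun _ => Fin 2 → ℝ) : solidSum t ℓ x ∈ harmonic ℓ := by
  rw [solidSum_apply]
  refine (harmonic ℓ).add_mem ((harmonic ℓ).smul_mem _ (solidFactor_mem_harmonic ℓ))
    ((harmonic ℓ).sum_mem fun i _ => ?_)
  have := solid_mem_harmonic (ℓ - (i.1 + 1)) (i.1 + 1) (twist t (x.2 i))
  rwa [show ℓ - (i.1 + 1) + (i.1 + 1) = ℓ by omega] at this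

lemma solidSum_sumE (t : Parity) (ℓ : ℕ) (k : O2)
    (x : ℝ × DirectSum (Fin ℓ) fun _ => Fin 2 → ℝ) :
    solidSum t ℓ (sumE t ℓ k x) = chi t k • subst (embO2 k).1 (solidSum t ℓ x) := by
  have h1 : (sumE t ℓ k x).1 = chi t k * x.1 := E0_apply t k x.1
  have h2 : ∀ i : Fin ℓ, (sumE t ℓ k x).2 i = E (i.1 + 1) k (x.2 i) := fun i => rfl
  simp only [solidSum_apply, h1, h2, map_add, map_sum, map_smul, map_mul, subst_solidFactor,
    subst_planar, twist_E, smul_add, Finset.smul_sum, mul_smul, mul_smul_comm]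

lemma solidSum_injective (t : Parity) (ℓ : ℕ) : Function.Injective (solidSum t ℓ) := by
  rw [injective_iff_map_eq_zero]
  intro x hx
  rw [solidSum_apply] at hx
  let u : Fin (ℓ + 1) → Poly := Fin.cons (x.1 • solidFactor ℓ 0) fun i : Fin ℓ =>
    solidFactor (ℓ - (i.1 + 1)) (i.1 + 1) * planar (i.1 + 1) (twist t (x.2 i))
  have hu : ∀ i ∈ Finset.univ, u i = 0 := by
    -- The summand of weight `i` is an eigenvector of `angular²` for `-i²`, and these values are
    -- distinct for natural `i`.
    have hind := (Module.End.eigenspaces_iSupIndep (angular ∘ₗ angular)).comp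
      (f := fun i : Fin (ℓ + 1) => (-(i.1 : ℝ) ^ 2)) fun i j hij => by
        have h : (i.1 : ℝ) ^ 2 = (j.1 : ℝ) ^ 2 := neg_injective hij
        have h' : (i.1 : ℝ) = j.1 := by
          rwa [sq_eq_sq₀ (Nat.cast_nonneg _) (Nat.cast_nonneg _)] at h
        exact Fin.ext (by exact_mod_cast h')
    refine (iSupIndep_iff_finsetSum_eq_zero_imp_eq_zero _).1 hind Finset.univ u (fun i _ => ?_) ?_
    · rw [Function.comp_apply, Module.End.mem_eigenspace_iff, LinearMap.comp_apply]
      refine Fin.cases ?_ (fun i => ?_) i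
      · simp [u, angular_solidFactor]
      · simp only [u, Fin.cons_succ, Fin.val_succ, angular_mul, angular_solidFactor, mul_zero,
          add_zero, angular_angular_planar, mul_smul_comm]
    · rw [Fin.sum_univ_succ]
      exact hx
  have h0 : x.1 = 0 := (smul_eq_zero.1 (hu 0 (Finset.mem_univ _))).resolve_right
    (solidFactor_ne_zero _ _)
  have h1 : ∀ i : Fin ℓ, x.2 i = 0 := fun i => by
    have h := (mul_eq_zero.1 (hu i.succ (Finset.mem_univ _))).resolve_left
      (solidFactor_ne_zero _ _)
    exact (map_eq_zero_iff _ (twist_injective t)).1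
      ((map_eq_zero_iff _ (planar_injective _ i.1.succ_ne_zero)).1 h)
  exact Prod.ext h0 (DFinsupp.ext h1)

/-! ### The dimension of the space of harmonic polynomials -/

/-- The exponent vector of `x^a y^b z^c`. -/
noncomputable def expo (a b c : ℕ) : Fin 3 →₀ ℕ :=
  Finsupp.single 0 a + Finsupp.single 1 b + Finsupp.single 2 c

lemma coeff_lap (p : Poly) (a b c : ℕ) : coeff (expo a b c) (lap p) =
    (a + 2) * (a + 1) * coeff (expo (a + 2) b c) p + (b + 2) * (b + 1) * coeff (expo a (b + 2) c) p
      + (c + 2) * (c + 1) * coeff (expo a b (c + 2)) p := by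
  have h0 : expo a b c + Finsupp.single 0 1 + Finsupp.single 0 1 = expo (a + 2) b c := by
    ext i; fin_cases i <;> simp [expo]
  have h1 : expo a b c + Finsupp.single 1 1 + Finsupp.single 1 1 = expo a (b + 2) c := by
    ext i; fin_cases i <;> simp [expo]
  have h2 : expo a b c + Finsupp.single 2 1 + Finsupp.single 2 1 = expo a b (c + 2) := by
    ext i; fin_cases i <;> simp [expo]
  simp only [lap_apply, coeff_add, coeff_pderiv, h0, h1, h2]
  simp [expo]
  ring

/-- The coefficients of a polynomial at the monomials of degree `ℓ` which are of degree at most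
one in `z`. -/
noncomputable def lowCoeff (ℓ : ℕ) : Poly →ₗ[ℝ] (Fin (ℓ + 1) → ℝ) × (Fin ℓ → ℝ) :=
  (LinearMap.pi fun i => lcoeff ℝ (expo i.1 (ℓ - i.1) 0)).prod
    (LinearMap.pi fun i => lcoeff ℝ (expo i.1 (ℓ - 1 - i.1) 1))

/-- Read along powers of `z`, Laplace's equation is a second-order recursion: the coefficients at
`z^(c+2)` follow from those at `z^c`. The induction therefore carries two consecutive exponents. -/
lemma eq_zero_of_lowCoeff (ℓ : ℕ) (p : Poly) (hp : p ∈ harmonic ℓ) (h : lowCoeff ℓ p = 0) :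
    p = 0 := by
  have hl : lap p = 0 := hp.2
  have key : ∀ c a b, coeff (expo a b c) p = 0 ∧ coeff (expo a b (c + 1)) p = 0 := by
    have hdeg : ∀ a b c, a + b + c ≠ ℓ → coeff (expo a b c) p = 0 := fun a b c hne => by
      refine IsHomogeneous.coeff_eq_zero hp.1 ?_
      simpa [expo, Finsupp.degree_eq_sum, Fin.sum_univ_three] using hne
    intro c
    induction c with
    | zero =>
      intro a b
      constructor
      · by_cases hab : a + b + 0 = ℓ
        · have := congrFun (congrArg Prod.fst h) ⟨a, by omega⟩
          simpa [lowCoeff, show ℓ - a = b by omega] using this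
        · exact hdeg _ _ _ hab
      · by_cases hab : a + b + (0 + 1) = ℓ
        · have := congrFun (congrArg Prod.snd h) ⟨a, by omega⟩
          simpa [lowCoeff, show ℓ - 1 - a = b by omega] using this
        · exact hdeg _ _ _ hab
    | succ c ih =>
      intro a b
      refine ⟨(ih a b).2, ?_⟩
      have := coeff_lap p a b c
      rw [hl, (ih _ _).1, (ih _ _).1, coeff_zero] at this
      have hc : ((c : ℝ) + 2) * (c + 1) ≠ 0 := by positivity
      have h3 : ((c : ℝ) + 2) * (c + 1) * coeff (expo a b (c + 2)) p = 0 := by linarith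
      exact (mul_eq_zero.1 h3).resolve_left hc
  ext d
  have hd : d = expo (d 0) (d 1) (d 2) := by
    ext i; fin_cases i <;> simp [expo]
  rw [hd, coeff_zero]
  exact (key _ _ _).1

lemma lowCoeff_harmonic_injective (ℓ : ℕ) :
    Function.Injective (lowCoeff ℓ ∘ₗ (harmonic ℓ).subtype) := by
  rw [injective_iff_map_eq_zero]
  exact fun p hp => Subtype.ext (eq_zero_of_lowCoeff ℓ p.1 p.2 hp)

instance harmonic_finite (ℓ : ℕ) : Module.Finite ℝ (harmonic ℓ) :=
  Module.Finite.of_injective _ (lowCoeff_harmonic_injective ℓ)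

lemma finrank_harmonic_le (ℓ : ℕ) : Module.finrank ℝ (harmonic ℓ) ≤ 1 + ℓ * 2 := by
  refine (LinearMap.finrank_le_finrank_of_injective (lowCoeff_harmonic_injective ℓ)).trans ?_
  simp
  omega

/-- The linear equivalence given by the solid harmonics. -/
noncomputable def solidEquiv (t : Parity) (ℓ : ℕ) :
    (ℝ × DirectSum (Fin ℓ) fun _ => Fin 2 → ℝ) ≃ₗ[ℝ] harmonic ℓ :=
  have hinj : Function.Injective ((solidSum t ℓ).codRestrict _ (solidSum_mem_harmonic t ℓ)) :=
    fun x y h => solidSum_injective t ℓ (congrArg Subtype.val h)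
  LinearEquiv.ofInjectiveOfFinrankEq _ hinj <|
    (LinearMap.finrank_le_finrank_of_injective hinj).antisymm <|
      (finrank_harmonic_le ℓ).trans_eq (by simp [Module.finrank_prod, Module.finrank_directSum])

lemma solidEquiv_coe (t : Parity) (ℓ : ℕ) (x : ℝ × DirectSum (Fin ℓ) fun _ => Fin 2 → ℝ) :
    (solidEquiv t ℓ x : Poly) = solidSum t ℓ x := rfl

/-! ### The restriction to `O(2)` -/

lemma aeval_smul_of_isHomogeneous {A : Type*} [CommRing A] [Algebra ℝ A] {n : ℕ} {p : Poly}
    (hp : p.IsHomogeneous n) (c : ℝ) (f : Fin 3 → A) :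
    aeval (fun i => c • f i) p = c ^ n • aeval f p := by
  rw [aeval_def, aeval_def, eval₂_eq', eval₂_eq', Finset.smul_sum]
  refine Finset.sum_congr rfl fun d hd => ?_
  have hdeg : ∑ i, d i = n := by
    rw [← Finsupp.degree_eq_sum]
    by_contra h
    exact mem_support_iff.1 hd (hp.coeff_eq_zero h)
  simp only [smul_pow, Finset.prod_smul, Finset.prod_pow_eq_pow_sum, hdeg, mul_smul_comm]

lemma subst_neg {n : ℕ} {p : Poly} (hp : p.IsHomogeneous n) (A : Matrix (Fin 3) (Fin 3) ℝ) :
    subst (-A) p = (-1 : ℝ) ^ n • subst A p := by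
  rw [subst, subst, ← aeval_smul_of_isHomogeneous hp]
  simp

lemma det_embO2 (k : O2) : (embO2 k).1.det = k.1.det := by
  simp [embO2, Matrix.det_fin_three, Matrix.det_fin_two]

lemma VSO3_coe (ℓ : ℕ) (g : SO3) (p : harmonic ℓ) : (VSO3 ℓ g p : Poly) = subst g.1 p := rfl

lemma VZ_apply (s : Parity) (z : Z2c) (k : O2) (h : z.1.1.det = k.1.det) (w : ℝ) :
    VZ s z w = chi s k * w := by
  cases s
  · simp [VZ, chi]
  · rw [chi, ← h]
    rfl

/-- Since `det g = 1`, the central factor `z` has the determinant of `k`. For rotations `z = e` and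
all characters are `1`; for reflections `g` is minus the embedded `k`, which costs `(-1)^ℓ`. -/
lemma resO2_VO3_tmul (ℓ : ℕ) (s t : Parity)
    (ht : ∀ k : O2, k.1.det = -1 → chi t k = (-1) ^ ℓ * chi s k)
    (k : O2) (p : harmonic ℓ) (w : ℝ) :
    (TensorProduct.rid ℝ (harmonic ℓ) (resO2 (VO3 ℓ s) k (p ⊗ₜ w)) : Poly) =
      chi t k • subst (embO2 k).1 (w • p : harmonic ℓ) := by
  obtain ⟨⟨g, z⟩, hgz⟩ := prodEquiv.surjective (embO2 k)
  have h1 : resO2 (VO3 ℓ s) k (p ⊗ₜ w) = VSO3 ℓ g p ⊗ₜ VZ s z w := by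
    change Representation.tprod (G := SO3 × Z2c) _ _ (prodEquiv.symm (embO2 k)) (p ⊗ₜ w) = _
    rw [← hgz, MulEquiv.symm_apply_apply]
    rfl
  have h2 : g.1 * z.1.1 = (embO2 k).1 := congrArg Subtype.val hgz
  have hg := (Matrix.mem_specialOrthogonalGroup_iff.1 g.2).2
  have hz : z.1.1.det = k.1.det := by
    rw [← det_embO2, ← h2, Matrix.det_mul, hg, one_mul]
  rw [h1, TensorProduct.rid_tmul, VZ_apply s z k hz, Submodule.coe_smul, VSO3_coe,
    Submodule.coe_smul, map_smul, smul_smul]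
  rcases z.2 with h | h
  · have hk : k.1.det = 1 := by rw [← hz, h, Matrix.det_one]
    have hc : ∀ t, chi t k = 1 := fun t => by cases t <;> simp [chi, hk]
    rw [← h2, h, mul_one, hc, hc]
  · have hk : k.1.det = -1 := by rw [← hz, h, Matrix.det_neg, Matrix.det_one]; norm_num
    have hs : ((-1 : ℝ) ^ ℓ) * (-1) ^ ℓ = 1 := by rw [← mul_pow]; norm_num
    rw [← h2, h, mul_neg, mul_one, subst_neg p.2.1, smul_smul, ht k hk]
    congr 1
    linear_combination -(chi s k * w) * hs

/-- The restriction of `V^{ℓ±}` to `O(2)` is a sum of irreducible representations. -/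
noncomputable def resEquiv (ℓ : ℕ) (s t : Parity)
    (ht : ∀ k : O2, k.1.det = -1 → chi t k = (-1) ^ ℓ * chi s k) :
    (resO2 (VO3 ℓ s)).Equiv (sumE t ℓ) :=
  Representation.Equiv.symm <| Representation.Equiv.mk
    ((solidEquiv t ℓ).trans (TensorProduct.rid ℝ (harmonic ℓ)).symm) fun k => by
      refine LinearMap.ext fun x => ?_
      apply (TensorProduct.rid ℝ (harmonic ℓ)).injective
      apply Subtype.ext
      simp only [LinearMap.comp_apply, LinearEquiv.coe_coe, LinearEquiv.trans_apply,
        TensorProduct.rid_symm_apply, resO2_VO3_tmul ℓ s t ht, TensorProduct.rid_tmul, one_smul,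
        solidEquiv_coe, solidSum_sumE]

lemma chi_even (ℓ : ℕ) (s : Parity) (k : O2) (_ : k.1.det = -1) :
    chi s k = (-1) ^ (2 * ℓ) * chi s k := by
  simp

lemma chi_odd (ℓ : ℕ) (s : Parity) (k : O2) (hk : k.1.det = -1) :
    chi s.opp k = (-1) ^ (2 * ℓ + 1) * chi s k := by
  cases s <;> simp [chi, Parity.opp, hk, pow_succ]

/-! ### Zonal harmonics -/

/-- The rotation of the plane by `φ`. -/
noncomputable def rot (φ : ℝ) : O2 :=
  ⟨!![Real.cos φ, -Real.sin φ; Real.sin φ, Real.cos φ], by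
    rw [Matrix.mem_orthogonalGroup_iff]
    have h := Real.sin_sq_add_cos_sq φ
    ext i j
    fin_cases i <;> fin_cases j <;> simp [Matrix.mul_apply, Fin.sum_univ_two] <;> linarith⟩

lemma rot_add (φ ψ : ℝ) : rot (φ + ψ) = rot φ * rot ψ := by
  apply Subtype.ext
  ext i j
  fin_cases i <;> fin_cases j <;>
    simp [rot, Real.cos_add, Real.sin_add] <;> ring

lemma rot_zero : rot 0 = 1 := by
  apply Subtype.ext
  ext i j
  fin_cases i <;> fin_cases j <;> simp [rot]

lemma rot_two_pi : rot (2 * Real.pi) = 1 := by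
  apply Subtype.ext
  ext i j
  fin_cases i <;> fin_cases j <;> simp [rot]

lemma rot_pow (φ : ℝ) (n : ℕ) : rot φ ^ n = rot (n * φ) := by
  induction n with
  | zero => simp [rot_zero]
  | succ n ih =>
    rw [pow_succ, ih, ← rot_add]
    congr 1
    push_cast
    ring

lemma det_rot (φ : ℝ) : (rot φ).1.det = 1 := by
  simp only [rot, Matrix.det_fin_two_of]
  linarith [Real.sin_sq_add_cos_sq φ]

/-- The rotation of space about the third axis by `φ`. -/
noncomputable def rotZ (φ : ℝ) : SO3 :=
  ⟨(embO2 (rot φ)).1, Matrix.mem_specialOrthogonalGroup_iff.2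
    ⟨(embO2 (rot φ)).2, by rw [det_embO2, det_rot]⟩⟩

lemma rotZ_pow_eq_one (ℓ : ℕ) : rotZ (2 * Real.pi / (ℓ + 1 : ℕ)) ^ (ℓ + 1) = 1 := by
  apply Subtype.ext
  have h : embO2 (rot (2 * Real.pi / (ℓ + 1 : ℕ))) ^ (ℓ + 1) = 1 := by
    rw [← map_pow, rot_pow, mul_div_cancel₀ _ (by positivity), rot_two_pi, map_one]
  have h' := congrArg Subtype.val h
  rw [SubmonoidClass.coe_pow] at h' ⊢
  exact h'

/-- On weight `m` with `1 ≤ m ≤ ℓ`, the rotation acts through the angle `2πm/(ℓ+1)`, strictly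
between `0` and `2π`, so it fixes no nonzero vector. A cyclic group of order `ℓ + 1` thus suffices
in place of the circle. -/
lemma eq_smul_solidFactor_of_fixed (ℓ : ℕ) (q : harmonic ℓ)
    (hq : VSO3 ℓ (rotZ (2 * Real.pi / (ℓ + 1 : ℕ))) q = q) :
    ∃ c : ℝ, (q : Poly) = c • solidFactor ℓ 0 := by
  set k := rot (2 * Real.pi / (ℓ + 1 : ℕ)) with hk
  obtain ⟨x, rfl⟩ := (solidEquiv .plus ℓ).surjective q
  have hx : sumE .plus ℓ k x = x := by
    apply solidSum_injective .plus ℓ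
    rw [solidSum_sumE, chi, one_smul]
    exact congrArg Subtype.val hq
  refine ⟨x.1, ?_⟩
  rw [solidEquiv_coe, solidSum_apply, add_eq_left]
  refine Finset.sum_eq_zero fun i _ => ?_
  have hi : E (i.1 + 1) k (x.2 i) = x.2 i := congrArg (fun y => y.2 i) hx
  change (EMatrix (i.1 + 1) !![_, _; _, _]).mulVec (x.2 i) = x.2 i at hi
  rw [EMatrix_rotation] at hi
  set θ : ℝ := ((i.1 + 1 : ℕ) : ℝ) * (2 * Real.pi / (ℓ + 1 : ℕ)) with hθ
  have hc : Real.cos θ ≠ 1 := by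
    have hpos : 0 < θ := by positivity
    have hlt : θ < 2 * Real.pi := by
      rw [hθ, mul_div_assoc', div_lt_iff₀ (by positivity), mul_comm]
      have : ((i.1 + 1 : ℕ) : ℝ) < (ℓ + 1 : ℕ) := by
        exact_mod_cast Nat.succ_lt_succ i.2
      gcongr
    rw [Ne, Real.cos_eq_one_iff_of_lt_of_lt (by linarith) hlt]
    exact hpos.ne'
  have e0 := congrFun hi 0
  have e1 := congrFun hi 1
  simp [Matrix.mulVec, dotProduct, Fin.sum_univ_two] at e0 e1
  have hs := Real.sin_sq_add_cos_sq θ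
  -- For the rotation matrix `R`, `(R - 1)ᵀ (R - 1) = 2 (1 - cos θ)`; applying `(R - 1)ᵀ` to `(R -
  -- 1) v = 0` isolates each coordinate.
  have hc' : (2 : ℝ) * (1 - Real.cos θ) ≠ 0 := mul_ne_zero two_ne_zero (sub_ne_zero.2 hc.symm)
  have v0 : x.2 i 0 = 0 := (mul_eq_zero.1 (show 2 * (1 - Real.cos θ) * x.2 i 0 = 0 by
    linear_combination (Real.cos θ - 1) * e0 + Real.sin θ * e1 - x.2 i 0 * hs)).resolve_left hc'
  have v1 : x.2 i 1 = 0 := (mul_eq_zero.1 (show 2 * (1 - Real.cos θ) * x.2 i 1 = 0 by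
    linear_combination -Real.sin θ * e0 + (Real.cos θ - 1) * e1 - x.2 i 1 * hs)).resolve_left hc'
  have : x.2 i = 0 := by
    ext j
    fin_cases j <;> simp [v0, v1]
  rw [this, map_zero, map_zero, mul_zero]

open MeasureTheory

/-! ### Irreducibility -/

lemma exists_rotation (u : Fin 3 → ℝ) (hu : u ⬝ᵥ u = 1) :
    ∃ g : SO3, g.1.mulVec ![0, 0, 1] = u := by
  obtain ⟨a, b, c, rfl⟩ : ∃ a b c, u = ![a, b, c] :=
    ⟨u 0, u 1, u 2, by ext i; fin_cases i <;> rfl⟩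
  have h : a ^ 2 + b ^ 2 + c ^ 2 = 1 := by
    simp [dotProduct, Fin.sum_univ_three] at hu
    linarith
  by_cases hc : 1 + c = 0
  · obtain rfl : c = -1 := by linarith
    have ha : a = 0 := by nlinarith [sq_nonneg a, sq_nonneg b]
    have hb : b = 0 := by nlinarith [sq_nonneg a, sq_nonneg b]
    subst ha hb
    refine ⟨⟨!![1, 0, 0; 0, -1, 0; 0, 0, -1], ?_⟩, ?_⟩
    · rw [Matrix.mem_specialOrthogonalGroup_iff, Matrix.mem_orthogonalGroup_iff]
      constructor
      · ext i j
        fin_cases i <;> fin_cases j <;> simp [Matrix.mul_apply, Fin.sum_univ_three]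
      · simp [Matrix.det_fin_three]
    · ext i
      fin_cases i <;> simp [Matrix.mulVec, dotProduct, Fin.sum_univ_three]
  · obtain ⟨d, hd⟩ : ∃ d, d * (1 + c) = 1 := ⟨(1 + c)⁻¹, inv_mul_cancel₀ hc⟩
    have hab : (a ^ 2 + b ^ 2) * d = 1 - c := by
      linear_combination d * h + (1 - c) * hd
    -- The rotation in the plane of the pole and `u`, with `d = 1 / (1 + c)`. It is undefined at the
    -- south pole, where a half turn about the first axis was used.
    refine ⟨⟨!![1 - a ^ 2 * d, -(a * b * d), a; -(a * b * d), 1 - b ^ 2 * d, b; -a, -b, c], ?_⟩, ?_⟩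
    · rw [Matrix.mem_specialOrthogonalGroup_iff, Matrix.mem_orthogonalGroup_iff]
      constructor
      · ext i j
        fin_cases i <;> fin_cases j <;> simp [Matrix.mul_apply, Fin.sum_univ_three]
        · linear_combination a ^ 2 * d * hab - a ^ 2 * hd
        · linear_combination a * b * d * hab - a * b * hd
        · linear_combination a * hab
        · linear_combination a * b * d * hab - a * b * hd
        · linear_combination b ^ 2 * d * hab - b ^ 2 * hd
        · linear_combination b * hab
        · linear_combination a * hab
        · linear_combination b * hab
        · linear_combination h
      · simp [Matrix.det_fin_three]
        linear_combination h - c * hab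
    · ext i
      fin_cases i <;> simp [Matrix.mulVec, dotProduct, Fin.sum_univ_three]

lemma eval_smul_of_isHomogeneous {n : ℕ} {p : Poly} (hp : p.IsHomogeneous n) (c : ℝ)
    (x : Fin 3 → ℝ) : eval (c • x) p = c ^ n * eval x p :=
  aeval_smul_of_isHomogeneous hp c x

lemma exists_eval_ne_zero (p : Poly) (hp : p ≠ 0) : ∃ x : Fin 3 → ℝ, eval x p ≠ 0 := by
  by_contra! h
  exact hp (MvPolynomial.funext fun x => by rw [h x, map_zero])

lemma exists_eval_pole_ne_zero (ℓ : ℕ) (p : harmonic ℓ) (hp : p ≠ 0) :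
    ∃ g : SO3, eval ![0, 0, 1] (VSO3 ℓ g p : Poly) ≠ 0 := by
  -- The extra factor `|x|²` forces the point of nonvanishing away from the origin, so that it can
  -- be normalised.
  have hq : (∑ i : Fin 3, X i * X i : Poly) ≠ 0 := fun h => by
    have := congrArg (eval ![0, 0, 1]) h
    simp [Fin.sum_univ_three] at this
  obtain ⟨x, hx⟩ := exists_eval_ne_zero (p.1 * ∑ i : Fin 3, X i * X i)
    (mul_ne_zero (fun h => hp (Subtype.ext h)) hq)
  rw [map_mul] at hx
  have hxx : eval x (∑ i : Fin 3, X i * X i : Poly) = x ⬝ᵥ x := by simp [dotProduct]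
  have h0 : x ⬝ᵥ x ≠ 0 := hxx ▸ right_ne_zero_of_mul hx
  have hpos : 0 < x ⬝ᵥ x := lt_of_le_of_ne
    (Finset.sum_nonneg fun i _ => mul_self_nonneg _) h0.symm
  set r := √(x ⬝ᵥ x) with hr
  have hrr : r * r = x ⬝ᵥ x := Real.mul_self_sqrt hpos.le
  have hr0 : r ≠ 0 := (Real.sqrt_pos.2 hpos).ne'
  obtain ⟨g, hg⟩ := exists_rotation (r⁻¹ • x) (by
    rw [smul_dotProduct, dotProduct_smul, smul_eq_mul, smul_eq_mul, ← hrr]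
    field_simp)
  refine ⟨g⁻¹, ?_⟩
  change eval _ (polyRep g⁻¹ p.1) ≠ 0
  rw [eval_polyRep, inv_inv, hg, eval_smul_of_isHomogeneous p.2.1]
  exact mul_ne_zero (pow_ne_zero _ (inv_ne_zero hr0)) (left_ne_zero_of_mul hx)

lemma eval_pole_rotZ (φ : ℝ) (p : Poly) :
    eval ![0, 0, 1] (polyRep (rotZ φ) p) = eval ![0, 0, 1] p := by
  rw [eval_polyRep]
  congr 2
  have : (rotZ φ)⁻¹.1 = (rotZ φ).1.transpose := rfl
  rw [this]
  ext i
  fin_cases i <;> simp [rotZ, embO2, Matrix.mulVec, dotProduct, Fin.sum_univ_three]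

/-- The zonal solid harmonic of degree `ℓ`. -/
noncomputable def zonal (ℓ : ℕ) : harmonic ℓ := ⟨solidFactor ℓ 0, solidFactor_mem_harmonic ℓ⟩

lemma zonal_ne_zero (ℓ : ℕ) : zonal ℓ ≠ 0 := fun h =>
  solidFactor_ne_zero ℓ 0 (congrArg Subtype.val h)

/-- The sum over the cyclic group stays in `W` and is fixed, hence a multiple of the zonal harmonic.
The multiple is nonzero because rotations about the axis preserve the value at the pole. -/
lemma zonal_mem (ℓ : ℕ) (W : Submodule ℝ (harmonic ℓ))
    (hW : ∀ g, ∀ p ∈ W, VSO3 ℓ g p ∈ W) (hne : W ≠ ⊥) : zonal ℓ ∈ W := by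
  obtain ⟨p₀, hp₀, hp0⟩ := W.exists_mem_ne_zero_of_ne_bot hne
  obtain ⟨g, hg⟩ := exists_eval_pole_ne_zero ℓ p₀ hp0
  set p := VSO3 ℓ g p₀
  have hp : p ∈ W := hW g p₀ hp₀
  set r := rotZ (2 * Real.pi / (ℓ + 1 : ℕ)) with hr
  set q := ∑ j ∈ Finset.range (ℓ + 1), VSO3 ℓ (r ^ j) p with hq
  have hqW : q ∈ W := W.sum_mem fun j _ => hW _ _ hp
  have hfix : VSO3 ℓ r q = q := by
    have h1 : VSO3 ℓ r q = ∑ j ∈ Finset.range (ℓ + 1), VSO3 ℓ (r ^ (j + 1)) p := by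
      rw [hq, map_sum]
      refine Finset.sum_congr rfl fun j _ => ?_
      rw [pow_succ', map_mul]
      rfl
    rw [h1, hq, Finset.sum_range_succ, Finset.sum_range_succ', rotZ_pow_eq_one, pow_zero]
  have heval : eval ![0, 0, 1] (q : Poly) = (ℓ + 1 : ℕ) * eval ![0, 0, 1] (p : Poly) := by
    have hj : ∀ j, eval ![0, 0, 1] (VSO3 ℓ (r ^ j) p : Poly) = eval ![0, 0, 1] (p : Poly) := by
      intro j
      induction j with
      | zero => rw [pow_zero, map_one]; rfl
      | succ j ih =>
        rw [pow_succ', map_mul, ← ih]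
        exact eval_pole_rotZ _ _
    rw [hq, Submodule.coe_sum, map_sum, Finset.sum_congr rfl fun j _ => hj j]
    simp
  obtain ⟨c, hc⟩ := eq_smul_solidFactor_of_fixed ℓ q hfix
  have hc0 : c ≠ 0 := by
    rintro rfl
    rw [hc, zero_smul, map_zero] at heval
    exact mul_ne_zero (by positivity) hg heval.symm
  have hz : zonal ℓ = c⁻¹ • q := Subtype.ext (by
    rw [Submodule.coe_smul, hc, inv_smul_smul₀ hc0]
    rfl)
  rw [hz]
  exact W.smul_mem _ hqW

/-- The closed Euclidean unit ball. -/
def unitBall : Set (Fin 3 → ℝ) := {x | x ⬝ᵥ x ≤ 1}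

lemma isCompact_unitBall : IsCompact unitBall := by
  refine Metric.isCompact_of_isClosed_isBounded ?_ ?_
  · exact isClosed_le (by unfold dotProduct; fun_prop) continuous_const
  · refine (Metric.isBounded_closedBall (x := (0 : Fin 3 → ℝ)) (r := 1)).subset fun x hx => ?_
    rw [mem_closedBall_zero_iff, pi_norm_le_iff_of_nonneg zero_le_one]
    intro i
    have h1 : x i * x i ≤ x ⬝ᵥ x :=
      Finset.single_le_sum (f := fun i => x i * x i) (fun i _ => mul_self_nonneg _)
        (Finset.mem_univ i)
    rw [Real.norm_eq_abs, ← sq_le_one_iff_abs_le_one, sq]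
    exact h1.trans hx

lemma integrableOn_eval (p : Poly) : IntegrableOn (fun x => eval x p) unitBall :=
  (MvPolynomial.continuous_eval p).continuousOn.integrableOn_compact isCompact_unitBall

/-- Integration over the unit ball. -/
noncomputable def ballIntegral : Poly →ₗ[ℝ] ℝ where
  toFun p := ∫ x in unitBall, eval x p
  map_add' p q := by
    simp only [map_add]
    exact integral_add (integrableOn_eval p) (integrableOn_eval q)
  map_smul' c p := by
    simp only [smul_eval]
    exact integral_const_mul c _

lemma ballIntegral_apply (p : Poly) : ballIntegral p = ∫ x in unitBall, eval x p := rfl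

/-- Rotations preserve both Lebesgue measure and the Euclidean ball. -/
lemma ballIntegral_polyRep (g : SO3) (p : Poly) : ballIntegral (polyRep g p) = ballIntegral p := by
  have hdet := (Matrix.mem_specialOrthogonalGroup_iff.1 (g⁻¹ : SO3).2).2
  have horth := (Matrix.mem_orthogonalGroup_iff' (Fin 3) ℝ).1
    (Matrix.mem_specialOrthogonalGroup_iff.1 (g⁻¹ : SO3).2).1
  have hmp : MeasurePreserving (Matrix.toLin' (g⁻¹ : SO3).1) (volume : Measure (Fin 3 → ℝ)) volume :=
    ⟨(LinearMap.continuous_of_finiteDimensional _).measurable, by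
      rw [Real.map_matrix_volume_pi_eq_smul_volume_pi (by rw [hdet]; norm_num), hdet]
      simp⟩
  have hinj : Function.Injective (Matrix.toLin' (g⁻¹ : SO3).1) := by
    intro x y hxy
    have := congrArg (fun v => Matrix.mulVec (g⁻¹ : SO3).1.transpose v) hxy
    simpa [Matrix.mulVec_mulVec, horth] using this
  have hemb : MeasurableEmbedding (Matrix.toLin' (g⁻¹ : SO3).1) :=
    (LinearMap.continuous_of_finiteDimensional _).measurableEmbedding hinj
  have hpre : Matrix.toLin' (g⁻¹ : SO3).1 ⁻¹' unitBall = unitBall := by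
    ext x
    change Matrix.mulVec _ x ⬝ᵥ Matrix.mulVec _ x ≤ 1 ↔ x ⬝ᵥ x ≤ 1
    rw [Matrix.dotProduct_mulVec, Matrix.vecMul_mulVec, horth, Matrix.vecMul_one]
  have := hmp.setIntegral_preimage_emb hemb (fun x => eval x p) unitBall
  rw [hpre] at this
  rw [ballIntegral_apply, ballIntegral_apply, ← this]
  simp only [eval_polyRep, Matrix.toLin'_apply]

lemma ballIntegral_self_pos (ℓ : ℕ) (p : Poly) (hp : p.IsHomogeneous ℓ) (h0 : p ≠ 0) :
    0 < ballIntegral (p * p) := by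
  rw [ballIntegral_apply, setIntegral_pos_iff_support_of_nonneg_ae
    (Filter.Eventually.of_forall fun x => by
      simp only [map_mul]
      exact mul_self_nonneg _) (integrableOn_eval _)]
  have hcont : Continuous fun x : Fin 3 → ℝ => x ⬝ᵥ x := by unfold dotProduct; fun_prop
  have hopen : IsOpen ({x : Fin 3 → ℝ | eval x (p * p) ≠ 0} ∩ {x | x ⬝ᵥ x < 1}) :=
    (isOpen_ne_fun (MvPolynomial.continuous_eval _) continuous_const).inter
      (isOpen_lt hcont continuous_const)
  refine (hopen.measure_pos volume ?_).trans_le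
    (measure_mono (Set.inter_subset_inter_right _ fun x (hx : x ⬝ᵥ x < 1) => hx.le))
  obtain ⟨x, hx⟩ := exists_eval_ne_zero p h0
  have hs : 0 ≤ x ⬝ᵥ x := Finset.sum_nonneg fun i _ => mul_self_nonneg _
  have hr : (1 + x ⬝ᵥ x)⁻¹ ≠ 0 := by positivity
  -- Homogeneity keeps the value nonzero after scaling, and `s / (1 + s)² < 1` puts the point in the
  -- open ball.
  refine ⟨(1 + x ⬝ᵥ x)⁻¹ • x, ?_, ?_⟩
  · have := mul_ne_zero (pow_ne_zero ℓ hr) hx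
    rw [Set.mem_ofPred_eq, map_mul, eval_smul_of_isHomogeneous hp]
    exact mul_ne_zero this this
  · rw [Set.mem_ofPred_eq, smul_dotProduct, dotProduct_smul, smul_eq_mul, smul_eq_mul]
    generalize x ⬝ᵥ x = s at hs
    rw [← mul_assoc, ← mul_inv, inv_mul_lt_iff₀ (by positivity)]
    nlinarith

/-- The `L²` inner product on the unit ball. -/
noncomputable def ballForm (ℓ : ℕ) : LinearMap.BilinForm ℝ (harmonic ℓ) :=
  ((LinearMap.mul ℝ Poly).compr₂ ballIntegral).compl₁₂ (harmonic ℓ).subtype (harmonic ℓ).subtype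

lemma ballForm_apply (ℓ : ℕ) (p q : harmonic ℓ) :
    ballForm ℓ p q = ballIntegral (p * q : Poly) := rfl

lemma ballForm_self_ne_zero (ℓ : ℕ) (p : harmonic ℓ) (hp : p ≠ 0) : ballForm ℓ p p ≠ 0 :=
  (ballIntegral_self_pos ℓ p p.2.1 fun h => hp (Subtype.ext h)).ne'

lemma ballForm_isRefl (ℓ : ℕ) : (ballForm ℓ).IsRefl := fun p q h => by
  rw [ballForm_apply] at h ⊢
  rwa [mul_comm]

lemma ballForm_invariant (ℓ : ℕ) (g : SO3) (p q : harmonic ℓ) :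
    ballForm ℓ (VSO3 ℓ g p) (VSO3 ℓ g q) = ballForm ℓ p q := by
  rw [ballForm_apply, ballForm_apply, VSO3_coe, VSO3_coe, ← map_mul]
  exact ballIntegral_polyRep g _

/-- If both `W` and its complement were nonzero, the zonal harmonic would lie in their trivial
intersection. -/
lemma invariant_eq_bot_or_top (ℓ : ℕ) (W : Submodule ℝ (harmonic ℓ))
    (hW : ∀ g, ∀ p ∈ W, VSO3 ℓ g p ∈ W) : W = ⊥ ∨ W = ⊤ := by
  set W' := (ballForm ℓ).orthogonal W with hW'
  have hdisj : Disjoint W W' := by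
    rw [Submodule.disjoint_def]
    intro p hp hp'
    by_contra h
    exact ballForm_self_ne_zero ℓ p h (LinearMap.BilinForm.mem_orthogonal_iff.1 hp' p hp)
  have hcompl := (LinearMap.BilinForm.isCompl_orthogonal_iff_disjoint (ballForm_isRefl ℓ)).2 hdisj
  have hinv : ∀ g, ∀ p ∈ W', VSO3 ℓ g p ∈ W' := by
    intro g p hp
    rw [hW', LinearMap.BilinForm.mem_orthogonal_iff] at hp ⊢
    intro q hq
    have := hp _ (hW g⁻¹ q hq)
    rwa [← ballForm_invariant ℓ g, ← Module.End.mul_apply, ← map_mul, mul_inv_cancel, map_one,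
      Module.End.one_apply] at this
  by_contra! hne
  have hne' : W' ≠ ⊥ := fun h => hne.2 (by
    have := hcompl.sup_eq_top
    rwa [← hW', h, sup_bot_eq] at this)
  exact zonal_ne_zero ℓ (Submodule.disjoint_def.1 hdisj _ (zonal_mem ℓ W hW hne.1)
    (zonal_mem ℓ W' hinv hne'))

theorem VSO3_isIrreducible (ℓ : ℕ) : (VSO3 ℓ).IsIrreducible where
  exists_pair_ne := ⟨⊥, ⊤, fun h => zonal_ne_zero ℓ <| by
    have h1 : (⊥ : Submodule ℝ (harmonic ℓ)) = ⊤ :=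
      congrArg Subrepresentation.toSubmodule h
    rw [← Submodule.mem_bot ℝ, h1]
    exact Submodule.mem_top⟩
  eq_bot_or_eq_top W :=
    (invariant_eq_bot_or_top ℓ W.toSubmodule fun g _ hp => W.apply_mem_toSubmodule g hp).imp
      (fun h => Subrepresentation.toSubmodule_injective h)
      (fun h => Subrepresentation.toSubmodule_injective h)

end O3Restriction

theorem mainTheorem3 :
    (∀ ℓ : ℕ, (O3Restriction.VSO3 ℓ).IsIrreducible) ∧
    ∀ (ℓ : ℕ) (s : O3Restriction.Parity),
      Nonempty ((O3Restriction.resO2 (O3Restriction.VO3 (2 * ℓ) s)).Equiv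
        (O3Restriction.sumE s (2 * ℓ))) ∧
      Nonempty ((O3Restriction.resO2 (O3Restriction.VO3 (2 * ℓ + 1) s)).Equiv
        (O3Restriction.sumE s.opp (2 * ℓ + 1))) :=
  ⟨O3Restriction.VSO3_isIrreducible, fun ℓ s =>
    ⟨⟨O3Restriction.resEquiv _ s s (O3Restriction.chi_even ℓ s)⟩,
      ⟨O3Restriction.resEquiv _ s s.opp (O3Restriction.chi_odd ℓ s)⟩⟩⟩
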